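/- Let $k\ge 0$ and $0\le j\le k+1$ be integers, and let $q,z$ be complex numbers with $0<|q|<1$ and $z\ne 0$. Write $(A;q)_n=\prod_{i=0}^{n-1}(1-Aq^i)$ for $0\le n\le\infty$, $(A,B,\dots;q)_n=(A;q)_n(B;q)_n\cdots$, and $(q)_n=(q;q)_n$. Then $$ \begin{aligned} \sum_{s_1\ge s_2\ge\cdots\ge s_{k+1}\ge 0}& \frac{q^{-s_1-\cdots-s_j}(1+q^{s_1+s_2})(1+q^{s_2+s_3})\cdots(1+q^{s_{j-1}+s_j})} {(q)_{s_1-s_2}\cdots(q)_{s_k-s_{k+1}}}\, \frac{(-z,-q/z;q)_{s_{k+1}}}{(q)_{2s_{k+1}}}\, q^{s_1^2+\cdots+s_{k+1}^2}\\ &=\sum_{s=0}^{j}\binom{j}{s} \frac{(-zq^{k+1+j-2s},\,-q^{k+2-j+2s}/z,\,q^{2k+3};\,q^{2k+3})_\infty}{(q;q)_\infty}, \end{aligned} $$ where the multiple sum, over all integer tuples $(s_1,\dots,s_{k+1})$ as indicated, converges absolutely. Moreover, put $b_1=q^{-s_1}$ and $b_i=q^{-s_i}(1+q^{s_{i-1}+s_i})$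 for $2\le i\le k+1$, so that the numerator $q^{-s_1-\cdots-s_j}(1+q^{s_1+s_2})\cdots(1+q^{s_{j-1}+s_j})$ above is $b_1b_2\cdots b_j$. For every $j$-element subset $J\subseteq\{1,\dots,k+1\}$, the identity remains true, with the same right-hand side and with absolute convergence, when this numerator is replaced by $\prod_{i\in J}b_i$. -/

import Mathlib

/-- The finite `q`-shifted factorial `(A; q)_n = ∏_{i=0}^{n-1} (1 - A q^i)`. -/
noncomputable def qPoch (A q : ℂ) (n : ℕ) : ℂ :=
  ∏ i ∈ Finset.range n, (1 - A * q ^ i)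

/-- The infinite `q`-shifted factorial `(A; q)_∞ = ∏_{i ≥ 0} (1 - A q^i)`
(the product converges absolutely when `‖q‖ < 1`). -/
noncomputable def qPochInf (A q : ℂ) : ℂ :=
  ∏' i : ℕ, (1 - A * q ^ i)

/-- The infinite product does converge for `‖q‖ < 1`, so that `qPochInf` is its value. -/
theorem qPochInf_hasProd (A q : ℂ) (hq : ‖q‖ < 1) :
    HasProd (fun i : ℕ => 1 - A * q ^ i) (qPochInf A q) := by
  have hs : Summable (fun i : ℕ => ‖-(A * q ^ i)‖) := by
    have h : (fun i : ℕ => ‖-(A * q ^ i)‖) = fun i : ℕ => ‖A‖ * ‖q‖ ^ i := by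
      funext i
      rw [norm_neg, norm_mul, norm_pow]
    rw [h]
    exact (summable_geometric_of_lt_one (norm_nonneg q) hq).mul_left _
  have hm := (multipliable_one_add_of_summable hs).hasProd
  simpa only [← sub_eq_add_neg, qPochInf] using hm

/-- The index set of the multiple sum: `s_1 ≥ s_2 ≥ ⋯ ≥ s_{k+1} ≥ 0`.
The entry `s_i` is `s ⟨i - 1, _⟩`. -/
abbrev DecTuple (k : ℕ) : Type := {s : Fin (k + 1) → ℕ // Antitone s}

/-- The part of the summand without binomial factors:
`q^{s_1^2 + ⋯ + s_{k+1}^2} / ((q)_{s_1-s_2} ⋯ (q)_{s_k-s_{k+1}})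
  * (-z, -q/z; q)_{s_{k+1}} / (q)_{2 s_{k+1}}`. -/
noncomputable def overTerm (k : ℕ) (q z : ℂ) (s : Fin (k + 1) → ℕ) : ℂ :=
  q ^ (∑ i, s i ^ 2) / (∏ i : Fin k, qPoch q q (s i.castSucc - s i.succ)) *
    (qPoch (-z) q (s (Fin.last k)) * qPoch (-q / z) q (s (Fin.last k)) /
      qPoch q q (2 * s (Fin.last k)))

/-- The `k + 1` binomial factors: `q^{-s_1}` for the first index, and
`q^{-s_i} (1 + q^{s_{i-1} + s_i})` for `2 ≤ i ≤ k + 1`. -/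
noncomputable def binomFactor (k : ℕ) (q : ℂ) (s : Fin (k + 1) → ℕ) (i : Fin (k + 1)) : ℂ :=
  Fin.cases (motive := fun _ => ℂ) (q ^ (-(s 0 : ℤ)))
    (fun m : Fin k => q ^ (-(s m.succ : ℤ)) * (1 + q ^ (s m.castSucc + s m.succ))) i

/-- The product side
`∑_{s=0}^j C(j,s) (-z q^{k+1+j-2s}, -q^{k+2-j+2s}/z, q^{2k+3}; q^{2k+3})_∞ / (q; q)_∞`. -/
noncomputable def overProductSide (k j : ℕ) (q z : ℂ) : ℂ :=
  ∑ s ∈ Finset.range (j + 1), (j.choose s : ℂ) *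
    (qPochInf (-z * q ^ ((k : ℤ) + 1 + j - 2 * s)) (q ^ (2 * k + 3)) *
      qPochInf (-q ^ ((k : ℤ) + 2 - j + 2 * s) / z) (q ^ (2 * k + 3)) *
      qPochInf (q ^ (2 * k + 3)) (q ^ (2 * k + 3)) / qPochInf q q)

open Filter Topology

/-! The proof iterates a Bailey-type lemma on bilateral pairs `β_n = ∑_{r∈ℤ} α_r / ((q)_{n-r}
(q)_{n+r})`. Replacing `β_n` by `∑_m q^{m²} w(n,m) β_m / (q)_{n-m}` multiplies `α_r` by `q^{r²}` if
`w = 1`, and by `q^{r²} (q^r + q^{-r})` if `w = q^{-m} (1 + q^{n+m})` (`bailey_kernel`,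
`BaileyPair.step`). These multipliers commute, so only the number `j` of binomial weights matters;
hence the freedom in `J`. The outermost step is taken with `n → ∞`, where the binomial weight
degenerates to `q^{-m}`; this is why `b_1` has no binomial (`BaileyPair.hasSum`).

The seed `α_r = z^r q^{r(r-1)/2}` (`baileyPair_theta`) supplies the innermost factor of the multiple
sum, which becomes `∑_r q^{(k+1)r²} (q^r + q^{-r})^j α_r / (q)_∞` (`hasSum_baileyTerm`). Expanding
the `j`-th power and applying the Jacobi triple product in base `q^{2k+3}` gives the right-hand
side. -/

/-! ### Finite `q`-factorials and their reciprocals -/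

theorem one_sub_pow_succ_ne_zero {q : ℂ} (hq : ‖q‖ < 1) (n : ℕ) : 1 - q ^ (n + 1) ≠ 0 := by
  intro h
  have h1 : ‖q ^ (n + 1)‖ < 1 := by
    rw [norm_pow]
    exact pow_lt_one₀ (norm_nonneg q) hq (Nat.succ_ne_zero n)
  rw [← sub_eq_zero.mp h] at h1
  simp at h1

theorem qPoch_zero (A q : ℂ) : qPoch A q 0 = 1 := by simp [qPoch]

theorem qPoch_succ (A q : ℂ) (n : ℕ) : qPoch A q (n + 1) = qPoch A q n * (1 - A * q ^ n) := by
  simp [qPoch, Finset.prod_range_succ]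

theorem qPoch_self_succ (q : ℂ) (n : ℕ) :
    qPoch q q (n + 1) = qPoch q q n * (1 - q ^ (n + 1)) := by
  rw [qPoch_succ, pow_succ']

theorem qPoch_self_ne_zero {q : ℂ} (hq : ‖q‖ < 1) (n : ℕ) : qPoch q q n ≠ 0 := by
  induction n with
  | zero => simp [qPoch_zero]
  | succ n ih =>
    rw [qPoch_self_succ]
    exact mul_ne_zero ih (one_sub_pow_succ_ne_zero hq n)

/-- The reciprocal `1 / (q; q)_n`, extended by zero to negative `n`. -/
noncomputable def qPochInv (q : ℂ) (n : ℤ) : ℂ :=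
  if 0 ≤ n then (qPoch q q n.toNat)⁻¹ else 0

theorem qPochInv_natCast (q : ℂ) (n : ℕ) : qPochInv q n = (qPoch q q n)⁻¹ := by
  simp [qPochInv]

theorem qPochInv_of_neg (q : ℂ) {n : ℤ} (hn : n < 0) : qPochInv q n = 0 := by
  simp [qPochInv, hn]

theorem qPochInv_zero (q : ℂ) : qPochInv q 0 = 1 := by
  simp [qPochInv, qPoch_zero]

/-- Extension by zero keeps the recurrence valid at every integer (at `n = 0` the factor `1 - q^0`
vanishes), so sums can be shifted without boundary cases. -/
theorem one_sub_zpow_mul_qPochInv {q : ℂ} (hq : ‖q‖ < 1) (n : ℤ) :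
    (1 - q ^ n) * qPochInv q n = qPochInv q (n - 1) := by
  rcases lt_trichotomy n 0 with h | rfl | h
  · rw [qPochInv_of_neg q h, qPochInv_of_neg q (by omega), mul_zero]
  · rw [qPochInv_of_neg q (n := 0 - 1) (by omega)]
    simp
  · obtain ⟨m, rfl⟩ : ∃ m : ℕ, n = ((m + 1 : ℕ) : ℤ) := ⟨n.toNat - 1, by omega⟩
    have e : ((m + 1 : ℕ) : ℤ) - 1 = (m : ℤ) := by push_cast; ring
    rw [e, qPochInv_natCast, qPochInv_natCast, qPoch_self_succ, zpow_natCast]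
    have h1 := one_sub_pow_succ_ne_zero hq m
    have h2 := qPoch_self_ne_zero hq m
    field_simp

/-! ### Two `q`-Vandermonde sums -/

/-- Induction on `N` with `a` free: in `1 - q^{N+1} = (1 - q^{N+1-i}) + q^{N+1-i} (1 - q^i)` the
first part lowers `N`, and the second, after `i ↦ i + 1`, is the sum for `(N, a + 1)`. -/
theorem sum_range_qPochInv {q : ℂ} (hq0 : q ≠ 0) (hq : ‖q‖ < 1) (N : ℕ) (a : ℤ) (ha : 0 ≤ a) :
    ∑ i ∈ Finset.range (N + 1), q ^ ((i : ℤ) ^ 2 + a * i) *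
        (qPochInv q i * qPochInv q ((N : ℤ) - i) * qPochInv q (i + a)) =
      qPochInv q N * qPochInv q (N + a) := by
  induction N generalizing a with
  | zero => simp [qPochInv_zero]
  | succ N ih =>
    have hN : (1 - q ^ ((N : ℤ) + 1)) ≠ 0 := by
      exact_mod_cast one_sub_pow_succ_ne_zero hq N
    have rN := one_sub_zpow_mul_qPochInv hq ((N : ℤ) + 1)
    have rNa := one_sub_zpow_mul_qPochInv hq ((N : ℤ) + 1 + a)
    have i1 := ih a ha
    have i2 := ih (a + 1) (by omega)
    have key : ∀ i : ℕ, (1 - q ^ ((N : ℤ) + 1)) * (q ^ ((i : ℤ) ^ 2 + a * i) *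
        (qPochInv q i * qPochInv q ((N : ℤ) + 1 - i) * qPochInv q (i + a))) =
        q ^ ((i : ℤ) ^ 2 + a * i) *
          (qPochInv q i * qPochInv q ((N : ℤ) - i) * qPochInv q (i + a)) +
        q ^ ((i : ℤ) ^ 2 + a * i + (N + 1 - i)) *
          (qPochInv q ((i : ℤ) - 1) * qPochInv q ((N : ℤ) + 1 - i) * qPochInv q (i + a)) := by
      intro i
      have r1 := one_sub_zpow_mul_qPochInv hq (i : ℤ)
      have r2 := one_sub_zpow_mul_qPochInv hq ((N : ℤ) + 1 - i)
      rw [show (N : ℤ) + 1 - i - 1 = N - i by ring] at r2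
      have e : q ^ ((N : ℤ) + 1) = q ^ ((N : ℤ) + 1 - i) * q ^ (i : ℤ) := by
        rw [← zpow_add₀ hq0]; congr 1; ring
      rw [← r1, ← r2, zpow_add₀ hq0 _ ((N : ℤ) + 1 - i), e]
      ring
    apply mul_left_cancel₀ hN
    push_cast
    rw [Finset.mul_sum, Finset.sum_congr rfl fun i _ => key i, Finset.sum_add_distrib,
      Finset.sum_range_succ, i1, Finset.sum_range_succ']
    have hshift : ∀ i : ℕ, q ^ (((i + 1 : ℕ) : ℤ) ^ 2 + a * ((i + 1 : ℕ) : ℤ) +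
          (N + 1 - ((i + 1 : ℕ) : ℤ))) *
        (qPochInv q (((i + 1 : ℕ) : ℤ) - 1) * qPochInv q ((N : ℤ) + 1 - ((i + 1 : ℕ) : ℤ)) *
          qPochInv q (((i + 1 : ℕ) : ℤ) + a)) =
        q ^ ((N : ℤ) + 1 + a) * (q ^ ((i : ℤ) ^ 2 + (a + 1) * i) *
          (qPochInv q i * qPochInv q ((N : ℤ) - i) * qPochInv q (i + (a + 1)))) := by
      intro i
      rw [← mul_assoc (q ^ ((N : ℤ) + 1 + a)), ← zpow_add₀ hq0]
      push_cast
      congr 1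
      · congr 1; ring
      · congr 1
        · congr 1 <;> congr 1 <;> ring
        · congr 1; ring
    rw [Finset.sum_congr rfl fun i _ => hshift i, ← Finset.mul_sum, i2]
    rw [show (N : ℤ) + 1 - 1 = N by ring] at rN
    rw [show (N : ℤ) + 1 + a - 1 = N + a by ring] at rNa
    rw [qPochInv_of_neg q (n := (N : ℤ) - (N + 1 : ℕ)) (by push_cast; omega),
      qPochInv_of_neg q (n := ((0 : ℕ) : ℤ) - 1) (by simp), ← rNa,
      show (N : ℤ) + (a + 1) = N + 1 + a by ring]
    linear_combination (-qPochInv q ((N : ℤ) + 1 + a)) * rN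

/-- Splitting `1 = q^i + (1 - q^i)` gives the previous sum at `(N, a)` and, after a shift of `i`,
`q^a` times the one at `(N - 1, a + 1)`. -/
theorem sum_range_qPochInv_shifted {q : ℂ} (hq0 : q ≠ 0) (hq : ‖q‖ < 1) (N : ℕ) (a : ℤ)
    (ha : 0 ≤ a) :
    ∑ i ∈ Finset.range (N + 1), q ^ ((i : ℤ) ^ 2 + (a - 1) * i) *
        (qPochInv q i * qPochInv q ((N : ℤ) - i) * qPochInv q (i + a)) =
      (1 + q ^ a - q ^ (N + a)) * (qPochInv q N * qPochInv q (N + a)) := by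
  have key : ∀ i : ℕ, q ^ ((i : ℤ) ^ 2 + (a - 1) * i) *
        (qPochInv q i * qPochInv q ((N : ℤ) - i) * qPochInv q (i + a)) =
      q ^ ((i : ℤ) ^ 2 + a * i) *
        (qPochInv q i * qPochInv q ((N : ℤ) - i) * qPochInv q (i + a)) +
      q ^ ((i : ℤ) ^ 2 + (a - 1) * i) *
        (qPochInv q ((i : ℤ) - 1) * qPochInv q ((N : ℤ) - i) * qPochInv q (i + a)) := by
    intro i
    have r1 := one_sub_zpow_mul_qPochInv hq (i : ℤ)
    have e : q ^ ((i : ℤ) ^ 2 + a * i) = q ^ ((i : ℤ) ^ 2 + (a - 1) * i) * q ^ (i : ℤ) := by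
      rw [← zpow_add₀ hq0]; congr 1; ring
    rw [← r1, e]
    ring
  rw [Finset.sum_congr rfl fun i _ => key i, Finset.sum_add_distrib,
    sum_range_qPochInv hq0 hq N a ha, Finset.sum_range_succ',
    qPochInv_of_neg q (n := ((0 : ℕ) : ℤ) - 1) (by simp)]
  have hshift : ∀ i : ℕ, q ^ (((i + 1 : ℕ) : ℤ) ^ 2 + (a - 1) * ((i + 1 : ℕ) : ℤ)) *
        (qPochInv q (((i + 1 : ℕ) : ℤ) - 1) * qPochInv q ((N : ℤ) - ((i + 1 : ℕ) : ℤ)) *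
          qPochInv q (((i + 1 : ℕ) : ℤ) + a)) =
        q ^ a * (q ^ ((i : ℤ) ^ 2 + (a + 1) * i) *
          (qPochInv q i * qPochInv q ((N : ℤ) - 1 - i) * qPochInv q (i + (a + 1)))) := by
    intro i
    rw [← mul_assoc (q ^ a), ← zpow_add₀ hq0]
    push_cast
    congr 1
    · congr 1; ring
    · congr 1
      · congr 1 <;> congr 1 <;> ring
      · congr 1; ring
  rw [Finset.sum_congr rfl fun i _ => hshift i, ← Finset.mul_sum]
  rcases N with _ | N
  · simp
  · have i2 := sum_range_qPochInv hq0 hq N (a + 1) (by omega)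
    have rN := one_sub_zpow_mul_qPochInv hq ((N : ℤ) + 1)
    rw [show (N : ℤ) + 1 - 1 = N by ring] at rN
    have e : (((N + 1 : ℕ) : ℤ)) - 1 = N := by push_cast; ring
    rw [e, i2, ← rN]
    push_cast
    rw [show (N : ℤ) + (a + 1) = N + 1 + a by ring, zpow_add₀ hq0 ((N : ℤ) + 1) a]
    ring

/-! ### One step of the Bailey lemma -/

/-- The weight of one summation step of the Bailey lemma, with or without the binomial factor. -/
noncomputable def stepWeight (q : ℂ) (p : Prop) [Decidable p] (n m : ℕ) : ℂ :=
  if p then q ^ (-(m : ℤ)) * (1 + q ^ (n + m)) else 1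

/-- The factor by which one step of the Bailey lemma multiplies `α_r`. -/
noncomputable def stepFactor (q : ℂ) (p : Prop) [Decidable p] (r : ℤ) : ℂ :=
  q ^ (r ^ 2) * (if p then q ^ r + q ^ (-r) else 1)

/-- With `m = r + i` both sums above apply at `a = 2r`. In the binomial case the weight is `q^{-m} +
q^n`; the term `-q^{N+a}` of the shifted sum cancels the contribution of `q^n`, leaving `q^{r²} (q^r
+ q^{-r})`. -/
theorem bailey_kernel_nat {q : ℂ} (hq0 : q ≠ 0) (hq : ‖q‖ < 1) (p : Prop) [Decidable p]
    (n r : ℕ) :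
    ∑ m ∈ Finset.range (n + 1), q ^ (m ^ 2) * stepWeight q p n m * qPochInv q ((n : ℤ) - m) *
        (qPochInv q ((m : ℤ) - r) * qPochInv q ((m : ℤ) + r)) =
      stepFactor q p r * (qPochInv q ((n : ℤ) - r) * qPochInv q ((n : ℤ) + r)) := by
  rcases lt_or_ge n r with h | h
  · rw [qPochInv_of_neg q (n := (n : ℤ) - r) (by omega), zero_mul, mul_zero]
    refine Finset.sum_eq_zero fun m hm => ?_
    rw [Finset.mem_range] at hm
    rw [qPochInv_of_neg q (n := (m : ℤ) - r) (by omega), zero_mul, mul_zero]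
  · obtain ⟨N, rfl⟩ := Nat.exists_eq_add_of_le h
    rw [add_assoc, Finset.sum_range_add, Finset.sum_eq_zero, zero_add]
    · have k0 := sum_range_qPochInv hq0 hq N (2 * r) (by positivity)
      have k1 := sum_range_qPochInv_shifted hq0 hq N (2 * r) (by positivity)
      have e1 : (((r + N : ℕ) : ℤ)) - r = N := by push_cast; ring
      have e2 : (((r + N : ℕ) : ℤ)) + r = N + 2 * r := by push_cast; ring
      rw [e1, e2]
      have t0 : ∀ i : ℕ, q ^ ((r + i) ^ 2) * qPochInv q (((r + N : ℕ) : ℤ) - (r + i : ℕ)) *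
          (qPochInv q (((r + i : ℕ) : ℤ) - r) * qPochInv q (((r + i : ℕ) : ℤ) + r)) =
          q ^ ((r : ℤ) ^ 2) * (q ^ ((i : ℤ) ^ 2 + 2 * r * i) *
          (qPochInv q i * qPochInv q ((N : ℤ) - i) * qPochInv q (i + 2 * r))) := by
        intro i
        rw [← zpow_natCast, ← mul_assoc (q ^ ((r : ℤ) ^ 2)), ← zpow_add₀ hq0]
        push_cast
        rw [show ((r : ℤ) + i) ^ 2 = (r : ℤ) ^ 2 + ((i : ℤ) ^ 2 + 2 * r * i) by ring,
          show (r : ℤ) + N - (r + i) = N - i by ring, show (r : ℤ) + i - r = i by ring,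
          show (r : ℤ) + i + r = i + 2 * r by ring]
        ring
      have t1 : ∀ i : ℕ, q ^ (-((r + i : ℕ) : ℤ)) * (q ^ ((r : ℤ) ^ 2) *
          (q ^ ((i : ℤ) ^ 2 + 2 * r * i) *
          (qPochInv q i * qPochInv q ((N : ℤ) - i) * qPochInv q (i + 2 * r)))) =
          q ^ ((r : ℤ) ^ 2 - r) * (q ^ ((i : ℤ) ^ 2 + (2 * r - 1) * i) *
          (qPochInv q i * qPochInv q ((N : ℤ) - i) * qPochInv q (i + 2 * r))) := by
        intro i
        simp only [← mul_assoc]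
        simp only [← zpow_add₀ hq0]
        congr 4
        push_cast
        ring
      by_cases hp : p
      · have t : ∀ i : ℕ, q ^ ((r + i) ^ 2) * stepWeight q p (r + N) (r + i) *
            qPochInv q (((r + N : ℕ) : ℤ) - (r + i : ℕ)) *
            (qPochInv q (((r + i : ℕ) : ℤ) - r) * qPochInv q (((r + i : ℕ) : ℤ) + r)) =
            q ^ ((r : ℤ) ^ 2 - r) * (q ^ ((i : ℤ) ^ 2 + (2 * r - 1) * i) *
            (qPochInv q i * qPochInv q ((N : ℤ) - i) * qPochInv q (i + 2 * r))) +
            q ^ (r + N) * (q ^ ((r : ℤ) ^ 2) * (q ^ ((i : ℤ) ^ 2 + 2 * r * i) *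
            (qPochInv q i * qPochInv q ((N : ℤ) - i) * qPochInv q (i + 2 * r)))) := by
          intro i
          have e : q ^ (-((r + i : ℕ) : ℤ)) * q ^ (r + i) = 1 := by
            rw [zpow_neg, zpow_natCast]
            exact inv_mul_cancel₀ (pow_ne_zero _ hq0)
          rw [← t1, ← t0, stepWeight, if_pos hp, pow_add q (r + N) (r + i)]
          linear_combination (q ^ ((r + i) ^ 2) * q ^ (r + N) *
            qPochInv q (((r + N : ℕ) : ℤ) - (r + i : ℕ)) *
            (qPochInv q (((r + i : ℕ) : ℤ) - r) * qPochInv q (((r + i : ℕ) : ℤ) + r))) * e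
        rw [Finset.sum_congr rfl fun i _ => t i, Finset.sum_add_distrib, ← Finset.mul_sum,
          ← Finset.mul_sum, ← Finset.mul_sum, k0, k1, stepFactor, if_pos hp]
        have h2 : q ^ ((2 : ℤ) * r) = q ^ r * q ^ r := by
          rw [two_mul, zpow_add₀ hq0, zpow_natCast]
        have hr : q ^ r ≠ 0 := pow_ne_zero _ hq0
        rw [zpow_sub₀ hq0, zpow_add₀ hq0, h2, pow_add, zpow_neg]
        simp only [zpow_natCast]
        field_simp
        ring
      · simp only [stepWeight, stepFactor, if_neg hp, mul_one]
        rw [Finset.sum_congr rfl fun i _ => t0 i, ← Finset.mul_sum, k0]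
    · intro m hm
      rw [Finset.mem_range] at hm
      rw [qPochInv_of_neg q (n := (m : ℤ) - r) (by omega), zero_mul, mul_zero]

theorem bailey_kernel {q : ℂ} (hq0 : q ≠ 0) (hq : ‖q‖ < 1) (p : Prop) [Decidable p]
    (n : ℕ) (r : ℤ) :
    ∑ m ∈ Finset.range (n + 1), q ^ (m ^ 2) * stepWeight q p n m * qPochInv q ((n : ℤ) - m) *
        (qPochInv q ((m : ℤ) - r) * qPochInv q ((m : ℤ) + r)) =
      stepFactor q p r * (qPochInv q ((n : ℤ) - r) * qPochInv q ((n : ℤ) + r)) := by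
  obtain ⟨a, rfl | rfl⟩ := r.eq_nat_or_neg
  · exact bailey_kernel_nat hq0 hq p n a
  · have h := bailey_kernel_nat hq0 hq p n a
    have hs : stepFactor q p (-(a : ℤ)) = stepFactor q p a := by
      simp only [stepFactor, neg_neg, neg_sq, add_comm]
    rw [hs]
    simpa only [sub_neg_eq_add, ← sub_eq_add_neg, mul_comm (qPochInv q ((_ : ℤ) - (a : ℤ)))] using h

/-- Bilateral Bailey pairs relative to `a = 1`. -/
def BaileyPair (q : ℂ) (α : ℤ → ℂ) (β : ℕ → ℂ) : Prop :=
  ∀ n : ℕ, HasSum (fun r : ℤ => α r * (qPochInv q ((n : ℤ) - r) * qPochInv q ((n : ℤ) + r))) (β n)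

theorem BaileyPair.step {q : ℂ} (hq0 : q ≠ 0) (hq : ‖q‖ < 1) {α : ℤ → ℂ} {β : ℕ → ℂ}
    (h : BaileyPair q α β) (p : Prop) [Decidable p] :
    BaileyPair q (fun r => stepFactor q p r * α r) (fun n => ∑ m ∈ Finset.range (n + 1),
      q ^ (m ^ 2) * stepWeight q p n m * qPochInv q ((n : ℤ) - m) * β m) := by
  intro n
  have hs := hasSum_sum (s := Finset.range (n + 1)) fun m _ => (h m).mul_left
    (q ^ (m ^ 2) * stepWeight q p n m * qPochInv q ((n : ℤ) - m))
  refine hs.congr_fun ?_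
  intro r
  have k := bailey_kernel hq0 hq p n r
  calc _ = α r * (stepFactor q p r * (qPochInv q ((n : ℤ) - r) * qPochInv q ((n : ℤ) + r))) := by
        ring
    _ = _ := by
        rw [← k, Finset.mul_sum]
        refine Finset.sum_congr rfl fun m _ => ?_
        ring

/-! ### The seed pair -/

/-- The coefficients `z^r q^{r(r-1)/2}` of the Jacobi triple product. -/
noncomputable def thetaCoeff (q z : ℂ) (r : ℤ) : ℂ := z ^ r * q ^ (r * (r - 1) / 2)

theorem thetaCoeff_succ {q z : ℂ} (hq0 : q ≠ 0) (hz : z ≠ 0) (r : ℤ) :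
    thetaCoeff q z (r + 1) = z * q ^ r * thetaCoeff q z r := by
  have e : (r + 1) * (r + 1 - 1) / 2 = r + r * (r - 1) / 2 := by
    rw [show (r + 1) * (r + 1 - 1) = r * (r - 1) + r * 2 by ring,
      Int.add_mul_ediv_right _ _ two_ne_zero, add_comm]
  rw [thetaCoeff, thetaCoeff, e, zpow_add₀ hq0, zpow_add_one₀ hz]
  ring

/-- A finite form of the Jacobi triple product. Passing from `n` to `n + 1` multiplies the numerator
by `(1 + z q^n)(1 + q^{n+1}/z)`; expanded, its terms in `z` and `z⁻¹` shift `r` by one. -/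
theorem baileyPair_theta {q z : ℂ} (hq0 : q ≠ 0) (hq : ‖q‖ < 1) (hz : z ≠ 0) :
    BaileyPair q (thetaCoeff q z)
      (fun n => qPoch (-z) q n * qPoch (-q / z) q n / qPoch q q (2 * n)) := by
  intro n
  induction n with
  | zero =>
    have := hasSum_single (f := fun r : ℤ => thetaCoeff q z r *
      (qPochInv q (((0 : ℕ) : ℤ) - r) * qPochInv q (((0 : ℕ) : ℤ) + r))) 0 (by
        intro r hr
        rcases lt_or_gt_of_ne hr with h | h
        · rw [qPochInv_of_neg q (n := ((0 : ℕ) : ℤ) + r) (by simpa using h)]; simp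
        · rw [qPochInv_of_neg q (n := ((0 : ℕ) : ℤ) - r) (by simpa using h)]; simp)
    simpa [thetaCoeff, qPochInv_zero, qPoch_zero] using this
  | succ n ih =>
    have h1 := ih.mul_left (1 + q ^ (2 * n + 1))
    have h2 := ((Equiv.subRight (1 : ℤ)).hasSum_iff.mpr ih).mul_left (z * q ^ n)
    have h3 := ((Equiv.addRight (1 : ℤ)).hasSum_iff.mpr ih).mul_left (z⁻¹ * q ^ (n + 1))
    have h4 := ((h1.add h2).add h3).mul_left
      ((1 - q ^ (2 * n + 1 + 1))⁻¹ * (1 - q ^ (2 * n + 1))⁻¹)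
    have n1 := one_sub_pow_succ_ne_zero hq (2 * n + 1)
    have n2 := one_sub_pow_succ_ne_zero hq (2 * n)
    have hval : qPoch (-z) q (n + 1) * qPoch (-q / z) q (n + 1) / qPoch q q (2 * (n + 1)) =
        (1 - q ^ (2 * n + 1 + 1))⁻¹ * (1 - q ^ (2 * n + 1))⁻¹ *
        ((1 + q ^ (2 * n + 1)) * (qPoch (-z) q n * qPoch (-q / z) q n / qPoch q q (2 * n)) +
        z * q ^ n * (qPoch (-z) q n * qPoch (-q / z) q n / qPoch q q (2 * n)) +
        z⁻¹ * q ^ (n + 1) * (qPoch (-z) q n * qPoch (-q / z) q n / qPoch q q (2 * n))) := by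
      rw [show 2 * (n + 1) = 2 * n + 1 + 1 by ring, qPoch_self_succ, qPoch_self_succ, qPoch_succ,
        qPoch_succ]
      have n3 := qPoch_self_ne_zero hq (2 * n)
      field_simp
      ring
    beta_reduce
    rw [hval]
    refine h4.congr_fun fun r => ?_
    simp only [Function.comp, Equiv.subRight_apply, Equiv.coe_addRight]
    have t1 := thetaCoeff_succ hq0 hz r
    have t2 := thetaCoeff_succ hq0 hz (r - 1)
    rw [sub_add_cancel] at t2
    -- All reciprocals are brought to the common factor `1 / ((q)_{n+1-r} (q)_{n+1+r})`, leaving a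
    -- rational identity.
    have c1 := one_sub_zpow_mul_qPochInv hq ((n : ℤ) + 1 - r)
    have c2 := one_sub_zpow_mul_qPochInv hq ((n : ℤ) - r)
    have c3 := one_sub_zpow_mul_qPochInv hq ((n : ℤ) + 1 + r)
    have c4 := one_sub_zpow_mul_qPochInv hq ((n : ℤ) + r)
    rw [show (n : ℤ) + 1 - r - 1 = n - r by ring] at c1
    rw [show (n : ℤ) + 1 + r - 1 = n + r by ring] at c3
    push_cast
    rw [show (n : ℤ) - (r - 1) = n + 1 - r by ring, show (n : ℤ) + (r - 1) = n + r - 1 by ring,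
      show (n : ℤ) - (r + 1) = n - r - 1 by ring, show (n : ℤ) + (r + 1) = n + 1 + r by ring,
      ← c2, ← c4, ← c1, ← c3, t1, t2]
    rw [zpow_sub_one₀ hq0]
    have hr : q ^ r ≠ 0 := zpow_ne_zero _ hq0
    have hn : q ^ n ≠ 0 := pow_ne_zero _ hq0
    simp only [zpow_sub₀ hq0, zpow_add₀ hq0, zpow_one, zpow_natCast]
    rw [eq_comm, inv_mul_eq_div, inv_mul_eq_div]
    field_simp
    ring

/-! ### Limits as `n → ∞` and the triple product -/

theorem tendsto_qPoch (A : ℂ) {q : ℂ} (hq : ‖q‖ < 1) :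
    Tendsto (qPoch A q) atTop (𝓝 (qPochInf A q)) :=
  (qPochInf_hasProd A q hq).tendsto_prod_nat

theorem qPochInf_self_ne_zero {q : ℂ} (hq : ‖q‖ < 1) : qPochInf q q ≠ 0 := by
  have hs : Summable (fun i : ℕ => ‖-(q * q ^ i)‖) := by
    simp only [norm_neg, norm_mul, norm_pow]
    exact (summable_geometric_of_lt_one (norm_nonneg q) hq).mul_left _
  have h := tprod_one_add_ne_zero_of_summable (f := fun i : ℕ => -(q * q ^ i)) (fun i => by
    rw [← sub_eq_add_neg, ← pow_succ']
    exact one_sub_pow_succ_ne_zero hq i) hs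
  simpa only [← sub_eq_add_neg, qPochInf] using h

theorem exists_norm_qPochInv_le {q : ℂ} (hq : ‖q‖ < 1) :
    ∃ C : ℝ, 0 ≤ C ∧ ∀ n : ℤ, ‖qPochInv q n‖ ≤ C := by
  obtain ⟨C, hC⟩ := (Metric.isBounded_range_of_tendsto _
    ((tendsto_qPoch q hq).inv₀ (qPochInf_self_ne_zero hq))).exists_norm_le
  have hC0 : 0 ≤ C := (norm_nonneg _).trans (hC _ ⟨0, rfl⟩)
  refine ⟨C, hC0, fun n => ?_⟩
  rcases lt_or_ge n 0 with h | h
  · rw [qPochInv_of_neg q h, norm_zero]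
    exact hC0
  · lift n to ℕ using h
    rw [qPochInv_natCast]
    exact hC _ ⟨n, rfl⟩

theorem tendsto_qPochInv {q : ℂ} (hq : ‖q‖ < 1) (r : ℤ) :
    Tendsto (fun n : ℕ => qPochInv q ((n : ℤ) + r)) atTop (𝓝 (qPochInf q q)⁻¹) := by
  have h1 : Tendsto (fun n : ℕ => ((n : ℤ) + r).toNat) atTop atTop := by
    refine tendsto_atTop.2 fun b => ?_
    filter_upwards [eventually_ge_atTop (b + r.natAbs)] with n hn
    omega
  have h2 := ((tendsto_qPoch q hq).inv₀ (qPochInf_self_ne_zero hq)).comp h1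
  refine h2.congr' ?_
  filter_upwards [eventually_ge_atTop r.natAbs] with n hn
  simp only [Function.comp, qPochInv]
  rw [if_pos (by omega)]

theorem BaileyPair.exists_norm_le {q : ℂ} (hq : ‖q‖ < 1) {α : ℤ → ℂ} {β : ℕ → ℂ}
    (h : BaileyPair q α β) (hα : Summable α) : ∃ B : ℝ, 0 ≤ B ∧ ∀ n : ℕ, ‖β n‖ ≤ B := by
  obtain ⟨C, hC0, hC⟩ := exists_norm_qPochInv_le hq
  refine ⟨∑' r, ‖α r‖ * (C * C), tsum_nonneg fun r => by positivity, fun n => ?_⟩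
  rw [← (h n).tsum_eq]
  refine tsum_of_norm_bounded (hα.norm.mul_right (C * C)).hasSum fun r => ?_
  rw [norm_mul, norm_mul]
  gcongr
  · exact hC _
  · exact hC _

theorem BaileyPair.tendsto {q : ℂ} (hq : ‖q‖ < 1) {α : ℤ → ℂ} {β : ℕ → ℂ}
    (h : BaileyPair q α β) (hα : Summable α) :
    Tendsto β atTop (𝓝 ((∑' r, α r) * ((qPochInf q q)⁻¹ * (qPochInf q q)⁻¹))) := by
  obtain ⟨C, hC0, hC⟩ := exists_norm_qPochInv_le hq
  have ht := tendsto_tsum_of_dominated_convergence (𝓕 := atTop)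
    (f := fun (n : ℕ) (r : ℤ) => α r * (qPochInv q ((n : ℤ) - r) * qPochInv q ((n : ℤ) + r)))
    (g := fun r => α r * ((qPochInf q q)⁻¹ * (qPochInf q q)⁻¹))
    (hα.norm.mul_right (C * C))
    (fun r => by
      have h1 := tendsto_qPochInv hq (-r)
      simp only [← sub_eq_add_neg] at h1
      exact (h1.mul (tendsto_qPochInv hq r)).const_mul (α r))
    (Eventually.of_forall fun n r => by
      rw [norm_mul, norm_mul]
      gcongr
      · exact hC _
      · exact hC _)
  rw [tsum_mul_right] at ht
  exact ht.congr fun n => (h n).tsum_eq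

theorem tendsto_qPoch_two_mul {q : ℂ} (hq : ‖q‖ < 1) :
    Tendsto (fun n => qPoch q q (2 * n)) atTop (𝓝 (qPochInf q q)) :=
  (tendsto_qPoch q hq).comp (tendsto_id.const_mul_atTop' two_pos)

theorem summable_thetaCoeff {q z : ℂ} (hq0 : q ≠ 0) (hq : ‖q‖ < 1) (hz : z ≠ 0) :
    Summable (thetaCoeff q z) := by
  have hne : ∀ r, thetaCoeff q z r ≠ 0 := fun r =>
    mul_ne_zero (zpow_ne_zero _ hz) (zpow_ne_zero _ hq0)
  have hp : Tendsto (fun n : ℕ => ‖q‖ ^ n) atTop (𝓝 0) :=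
    tendsto_pow_atTop_nhds_zero_of_lt_one (norm_nonneg q) hq
  apply Summable.of_nat_of_neg
  · refine summable_of_ratio_test_tendsto_lt_one zero_lt_one (Eventually.of_forall fun n => hne n) ?_
    have h := hp.const_mul ‖z‖
    rw [mul_zero] at h
    refine h.congr fun n => ?_
    push_cast
    rw [thetaCoeff_succ hq0 hz, norm_mul, norm_mul, zpow_natCast, norm_pow,
      mul_div_cancel_right₀ _ (norm_ne_zero_iff.2 (hne n))]
  · refine summable_of_ratio_test_tendsto_lt_one zero_lt_one
      (Eventually.of_forall fun n => hne _) ?_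
    have h := (hp.comp (tendsto_add_atTop_nat 1)).const_mul ‖z‖⁻¹
    rw [mul_zero] at h
    refine h.congr fun n => ?_
    have t := thetaCoeff_succ hq0 hz (-((n + 1 : ℕ) : ℤ))
    rw [show -((n + 1 : ℕ) : ℤ) + 1 = -(n : ℤ) by push_cast; ring, zpow_neg, zpow_natCast] at t
    rw [t, norm_mul, norm_mul, norm_inv, norm_pow]
    have h1 := norm_ne_zero_iff.2 (hne (-((n + 1 : ℕ) : ℤ)))
    have h2 := norm_ne_zero_iff.2 hz
    have h3 := norm_ne_zero_iff.2 hq0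
    simp only [Function.comp]
    field_simp

/-- The Jacobi triple product identity. -/
theorem hasSum_thetaCoeff {q z : ℂ} (hq0 : q ≠ 0) (hq : ‖q‖ < 1) (hz : z ≠ 0) :
    HasSum (thetaCoeff q z) (qPochInf (-z) q * qPochInf (-q / z) q * qPochInf q q) := by
  have hs := summable_thetaCoeff hq0 hq hz
  have h0 := qPochInf_self_ne_zero hq
  -- The limit of the seed `β_n` is computed from the pair and from the closed form; equating the
  -- two gives the identity.
  have t1 := (baileyPair_theta hq0 hq hz).tendsto hq hs
  have t2 := ((tendsto_qPoch (-z) hq).mul (tendsto_qPoch (-q / z) hq)).div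
    (tendsto_qPoch_two_mul hq) h0
  have e := tendsto_nhds_unique t1 t2
  convert hs.hasSum using 1
  generalize qPochInf (-q / z) q = X at e ⊢
  field_simp at e
  linear_combination -e

/-! ### Bounds and the limiting step -/

/-- The factor `q^{-m}` is absorbed by `q^{m²}`, so the bound is uniform in `n` and summable in `m`.
-/
theorem norm_pow_sq_mul_stepWeight_le {q : ℂ} (hq0 : q ≠ 0) (hq : ‖q‖ < 1) (p : Prop)
    [Decidable p] (n m : ℕ) : ‖q ^ (m ^ 2) * stepWeight q p n m‖ ≤ 2 * ‖q‖ ^ (m * (m - 1)) := by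
  have e : m ^ 2 = m * (m - 1) + m := by
    rcases m with _ | m
    · rfl
    · simp; ring
  have h1 : ‖q‖ ^ m ≤ 1 := pow_le_one₀ (norm_nonneg q) hq.le
  have h0 : 0 ≤ ‖q‖ ^ (m * (m - 1)) := by positivity
  rw [stepWeight]
  split_ifs
  · have e2 : q ^ (m ^ 2) * (q ^ (-(m : ℤ)) * (1 + q ^ (n + m))) =
        q ^ (m * (m - 1)) * (1 + q ^ (n + m)) := by
      rw [e, pow_add, zpow_neg, zpow_natCast]
      have := pow_ne_zero m hq0
      field_simp
    rw [e2, norm_mul, norm_pow, mul_comm]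
    gcongr
    refine (norm_add_le _ _).trans ?_
    have : ‖q‖ ^ (n + m) ≤ 1 := pow_le_one₀ (norm_nonneg q) hq.le
    rw [norm_one, norm_pow]
    linarith
  · rw [mul_one, norm_pow, e, pow_add]
    nlinarith

theorem summable_norm_pow_mul_pred {q : ℂ} (hq : ‖q‖ < 1) :
    Summable fun m : ℕ => ‖q‖ ^ (m * (m - 1)) := by
  refine (summable_nat_add_iff 1).1 ?_
  refine (summable_geometric_of_lt_one (norm_nonneg q) hq).of_nonneg_of_le
    (fun m => by positivity) fun m => ?_
  refine pow_le_pow_of_le_one (norm_nonneg q) hq.le ?_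
  rw [Nat.add_sub_cancel]
  exact Nat.le_mul_of_pos_left m m.succ_pos

theorem norm_zpow_le_one {q : ℂ} (hq : ‖q‖ < 1) {m : ℤ} (hm : 0 ≤ m) : ‖q ^ m‖ ≤ 1 := by
  lift m to ℕ using hm
  rw [zpow_natCast, norm_pow]
  exact pow_le_one₀ (norm_nonneg q) hq.le

theorem norm_stepFactor_le {q : ℂ} (hq0 : q ≠ 0) (hq : ‖q‖ < 1) (p : Prop) [Decidable p]
    (r : ℤ) : ‖stepFactor q p r‖ ≤ 2 := by
  rw [stepFactor]
  split_ifs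
  · rw [mul_add, ← zpow_add₀ hq0, ← zpow_add₀ hq0]
    have h1 : 0 ≤ r ^ 2 + r := by
      rcases le_or_gt 0 r with h | h <;> nlinarith
    have h2 : 0 ≤ r ^ 2 + -r := by
      rcases le_or_gt r 0 with h | h <;> nlinarith
    have := norm_add_le (q ^ (r ^ 2 + r)) (q ^ (r ^ 2 + -r))
    linarith [norm_zpow_le_one hq h1, norm_zpow_le_one hq h2]
  · rw [mul_one]
    linarith [norm_zpow_le_one hq (sq_nonneg r)]

theorem Summable.stepFactor_mul {q : ℂ} (hq0 : q ≠ 0) (hq : ‖q‖ < 1) {α : ℤ → ℂ}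
    (hα : Summable α) (p : Prop) [Decidable p] : Summable fun r => stepFactor q p r * α r := by
  refine (hα.norm.mul_left 2).of_norm_bounded fun r => ?_
  rw [norm_mul]
  gcongr
  exact norm_stepFactor_le hq0 hq p r

/-- Dominated convergence applied to `BaileyPair.step`: the limit of a pair carries `(q)_∞⁻²`, and
the limit of `1/(q)_{n-m}` accounts for one of these factors. -/
theorem BaileyPair.hasSum {q : ℂ} (hq0 : q ≠ 0) (hq : ‖q‖ < 1) {α : ℤ → ℂ} {β : ℕ → ℂ}
    (h : BaileyPair q α β) (hα : Summable α) (p : Prop) [Decidable p] :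
    HasSum (fun m : ℕ => (if p then q ^ (-(m : ℤ)) else 1) * (q ^ (m ^ 2) * β m))
      ((qPochInf q q)⁻¹ * ∑' r, stepFactor q p r * α r) := by
  obtain ⟨C, hC0, hC⟩ := exists_norm_qPochInv_le hq
  obtain ⟨B, hB0, hB⟩ := h.exists_norm_le hq hα
  have h0 := qPochInf_self_ne_zero hq
  set L := (qPochInf q q)⁻¹ with hL
  have t1 := (h.step hq0 hq p).tendsto hq (hα.stepFactor_mul hq0 hq p)
  have hbound : ∀ n m : ℕ, ‖q ^ (m ^ 2) * stepWeight q p n m * qPochInv q ((n : ℤ) - m) * β m‖ ≤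
      2 * ‖q‖ ^ (m * (m - 1)) * C * B := by
    intro n m
    rw [norm_mul, norm_mul]
    gcongr
    · exact norm_pow_sq_mul_stepWeight_le hq0 hq p n m
    · exact hC _
    · exact hB _
  have hsb : Summable fun m : ℕ => 2 * ‖q‖ ^ (m * (m - 1)) * C * B :=
    (((summable_norm_pow_mul_pred hq).mul_left 2).mul_right C).mul_right B
  have hlim : ∀ m : ℕ, Tendsto (fun n : ℕ =>
      q ^ (m ^ 2) * stepWeight q p n m * qPochInv q ((n : ℤ) - m) * β m) atTop
      (𝓝 (q ^ (m ^ 2) * (if p then q ^ (-(m : ℤ)) else 1) * L * β m)) := by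
    intro m
    have hw : Tendsto (fun n : ℕ => stepWeight q p n m) atTop
        (𝓝 (if p then q ^ (-(m : ℤ)) else 1)) := by
      simp only [stepWeight]
      split_ifs
      · have := ((tendsto_pow_atTop_nhds_zero_of_norm_lt_one hq).comp
          (tendsto_add_atTop_nat m)).const_add 1
        have := this.const_mul (q ^ (-(m : ℤ)))
        rw [add_zero, mul_one] at this
        exact this
      · exact tendsto_const_nhds
    have h1 := tendsto_qPochInv hq (-(m : ℤ))
    simp only [← sub_eq_add_neg] at h1
    exact ((hw.const_mul _).mul h1).mul_const _
  have t2 := tendsto_tsum_of_dominated_convergence hsb hlim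
    (Eventually.of_forall fun n m => hbound n m)
  have hfin : ∀ n : ℕ, ∑' m : ℕ, q ^ (m ^ 2) * stepWeight q p n m * qPochInv q ((n : ℤ) - m) * β m
      = ∑ m ∈ Finset.range (n + 1),
        q ^ (m ^ 2) * stepWeight q p n m * qPochInv q ((n : ℤ) - m) * β m := by
    intro n
    refine tsum_eq_sum fun m hm => ?_
    rw [Finset.mem_range] at hm
    rw [qPochInv_of_neg q (by omega), mul_zero, zero_mul]
  simp only [hfin] at t2
  have e := tendsto_nhds_unique t1 t2
  -- The bound uniform in `n` passes to the limit term.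
  have hsum : Summable fun m : ℕ => q ^ (m ^ 2) * (if p then q ^ (-(m : ℤ)) else 1) * L * β m :=
    hsb.of_norm_bounded fun m =>
      le_of_tendsto (hlim m).norm (Eventually.of_forall fun n => hbound n m)
  have hs := hsum.hasSum.mul_left (qPochInf q q)
  rw [← e] at hs
  have hLe : qPochInf q q * L = 1 := mul_inv_cancel₀ h0
  have hval : L * ∑' r, stepFactor q p r * α r =
      qPochInf q q * ((∑' r, stepFactor q p r * α r) * (L * L)) := by
    linear_combination (-L * ∑' r, stepFactor q p r * α r) * hLe
  rw [hval]
  refine hs.congr_fun fun m => ?_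
  linear_combination (-(if p then q ^ (-(m : ℤ)) else 1) * (q ^ (m ^ 2) * β m)) * hLe

/-! ### The multiple sum over decreasing tuples -/

/-- A finite set of tuples lies in a box, over which the sum factors. -/
theorem summable_prod_apply {f : ℕ → ℝ} (hf0 : ∀ m, 0 ≤ f m) (hf : Summable f) (n : ℕ) :
    Summable fun s : Fin n → ℕ => ∏ i, f (s i) := by
  refine summable_of_sum_le (c := (∑' m, f m) ^ n)
    (fun s => Finset.prod_nonneg fun i _ => hf0 _) fun u => ?_
  have hu : u ⊆ Fintype.piFinset fun i => u.image fun s => s i := fun s hs =>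
    Fintype.mem_piFinset.2 fun i => Finset.mem_image_of_mem _ hs
  calc ∑ s ∈ u, ∏ i, f (s i)
      ≤ ∑ s ∈ Fintype.piFinset fun i => u.image fun s => s i, ∏ i, f (s i) :=
        Finset.sum_le_sum_of_subset_of_nonneg hu fun s _ _ => Finset.prod_nonneg fun i _ => hf0 _
    _ = ∏ i : Fin n, ∑ m ∈ u.image fun s => s i, f m := (Finset.prod_univ_sum _ _).symm
    _ ≤ ∏ _i : Fin n, ∑' m, f m := by
        refine Finset.prod_le_prod (fun i _ => Finset.sum_nonneg fun m _ => hf0 m) fun i _ => ?_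
        exact hf.sum_le_tsum _ fun m _ => hf0 m
    _ = (∑' m, f m) ^ n := by simp

theorem prod_finset_fin_castSucc {n : ℕ} (J : Finset (Fin (n + 1))) (f : Fin (n + 1) → ℂ) :
    ∏ i ∈ J, f i = (∏ i : Fin n with i.castSucc ∈ J, f i.castSucc) *
      (if Fin.last n ∈ J then f (Fin.last n) else 1) := by
  rw [Finset.prod_filter, ← Fin.prod_univ_castSucc (fun i => if i ∈ J then f i else 1),
    Finset.prod_ite_mem, Finset.univ_inter]

/-- Splitting off the last entry of a decreasing tuple. -/
def decTupleSuccEquiv (k : ℕ) : DecTuple (k + 1) ≃ Σ t : DecTuple k, Fin (t.1 (Fin.last k) + 1) where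
  toFun s := ⟨⟨fun i => s.1 i.castSucc, fun _ _ h => s.2 (Fin.castSucc_le_castSucc_iff.2 h)⟩,
    ⟨s.1 (Fin.last (k + 1)), Nat.lt_succ_of_le (s.2 (Fin.le_last _))⟩⟩
  invFun x := ⟨Fin.snoc (α := fun _ => ℕ) x.1.1 x.2, by
    intro i j hij
    induction j using Fin.lastCases with
    | last =>
      induction i using Fin.lastCases with
      | last => exact le_rfl
      | cast i =>
        rw [Fin.snoc_last, Fin.snoc_castSucc]
        exact (Nat.le_of_lt_succ x.2.2).trans (x.1.2 (Fin.le_last _))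
    | cast j =>
      induction i using Fin.lastCases with
      | last => exact absurd hij (not_le_of_gt (Fin.castSucc_lt_last j))
      | cast i =>
        rw [Fin.snoc_castSucc, Fin.snoc_castSucc]
        exact x.1.2 (Fin.castSucc_le_castSucc_iff.1 hij)⟩
  left_inv s := by
    apply Subtype.ext
    funext i
    induction i using Fin.lastCases with
    | last => simp
    | cast i => simp
  right_inv x := by
    obtain ⟨⟨t, ht⟩, m⟩ := x
    simp only [Fin.snoc_castSucc, Fin.snoc_last, Sigma.mk.injEq, true_and]
    exact (Fin.heq_ext_iff (by simp)).2 rfl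

/-- The summand of the multiple sum attached to a general sequence `β`. -/
noncomputable def baileyTerm (k : ℕ) (q : ℂ) (J : Finset (Fin (k + 1))) (β : ℕ → ℂ)
    (s : Fin (k + 1) → ℕ) : ℂ :=
  (∏ i ∈ J, binomFactor k q s i) *
    (q ^ (∑ i, s i ^ 2) / (∏ i : Fin k, qPoch q q (s i.castSucc - s i.succ)) * β (s (Fin.last k)))

theorem binomFactor_snoc_castSucc (k : ℕ) (q : ℂ) (t : Fin (k + 1) → ℕ) (m : ℕ)
    (i : Fin (k + 1)) :
    binomFactor (k + 1) q (Fin.snoc (α := fun _ => ℕ) t m) i.castSucc = binomFactor k q t i := by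
  induction i using Fin.cases with
  | zero =>
    have h0 : (Fin.snoc (α := fun _ => ℕ) t m : Fin (k + 2) → ℕ) 0 = t 0 :=
      Fin.snoc_castSucc (α := fun _ => ℕ) m t 0
    simp only [binomFactor, Fin.castSucc_zero, Fin.cases_zero, h0]
  | succ i =>
    have h0 : (Fin.snoc (α := fun _ => ℕ) t m : Fin (k + 2) → ℕ) i.castSucc.succ = t i.succ := by
      rw [Fin.succ_castSucc]
      exact Fin.snoc_castSucc (α := fun _ => ℕ) m t i.succ
    simp only [binomFactor, ← Fin.succ_castSucc, Fin.cases_succ, h0, Fin.snoc_castSucc]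

theorem binomFactor_snoc_last (k : ℕ) (q : ℂ) (t : Fin (k + 1) → ℕ) (m : ℕ) :
    binomFactor (k + 1) q (Fin.snoc (α := fun _ => ℕ) t m) (Fin.last (k + 1)) =
      q ^ (-(m : ℤ)) * (1 + q ^ (t (Fin.last k) + m)) := by
  have h0 : (Fin.snoc (α := fun _ => ℕ) t m : Fin (k + 2) → ℕ) (Fin.last k).succ = m := by
    rw [Fin.succ_last]
    exact Fin.snoc_last (α := fun _ => ℕ) m t
  simp only [binomFactor, ← Fin.succ_last, Fin.cases_succ, h0, Fin.snoc_castSucc]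

theorem baileyTerm_snoc (k : ℕ) (q : ℂ) (J : Finset (Fin (k + 2))) (β : ℕ → ℂ)
    (t : Fin (k + 1) → ℕ) (m : ℕ) (hm : m ≤ t (Fin.last k)) :
    baileyTerm (k + 1) q J β (Fin.snoc (α := fun _ => ℕ) t m) =
      (∏ i : Fin (k + 1) with i.castSucc ∈ J, binomFactor k q t i) *
      (q ^ (∑ i, t i ^ 2) / (∏ i : Fin k, qPoch q q (t i.castSucc - t i.succ)) *
        (q ^ (m ^ 2) * stepWeight q (Fin.last (k + 1) ∈ J) (t (Fin.last k)) m *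
          qPochInv q ((t (Fin.last k) : ℤ) - m) * β m)) := by
  have hsub : ((t (Fin.last k) : ℤ) - m) = ((t (Fin.last k) - m : ℕ) : ℤ) := by
    push_cast [hm]; ring
  rw [baileyTerm, prod_finset_fin_castSucc, binomFactor_snoc_last, ← stepWeight,
    Fin.sum_univ_castSucc, Fin.prod_univ_castSucc, hsub, qPochInv_natCast]
  simp only [binomFactor_snoc_castSucc, Fin.snoc_castSucc, Fin.snoc_last, Fin.succ_last,
    Fin.succ_castSucc]
  rw [pow_add, div_eq_mul_inv, div_eq_mul_inv, mul_inv]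
  ring

theorem norm_pow_sq_mul_binomFactor_le (k : ℕ) {q : ℂ} (hq0 : q ≠ 0) (hq : ‖q‖ < 1)
    (s : Fin (k + 1) → ℕ) (J : Finset (Fin (k + 1))) (i : Fin (k + 1)) :
    ‖q ^ (s i ^ 2) * (if i ∈ J then binomFactor k q s i else 1)‖ ≤
      2 * ‖q‖ ^ (s i * (s i - 1)) := by
  split_ifs with hi
  · induction i using Fin.cases with
    | zero =>
      have e : s 0 ^ 2 = s 0 * (s 0 - 1) + s 0 := by
        rcases s 0 with _ | m
        · rfl
        · simp; ring
      have e2 : q ^ (s 0 ^ 2) * binomFactor k q s 0 = q ^ (s 0 * (s 0 - 1)) := by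
        simp only [binomFactor, Fin.cases_zero]
        rw [e, pow_add, zpow_neg, zpow_natCast]
        have := pow_ne_zero (s 0) hq0
        field_simp
      rw [e2, norm_pow]
      linarith [show 0 ≤ ‖q‖ ^ (s 0 * (s 0 - 1)) by positivity]
    | succ i =>
      have h := norm_pow_sq_mul_stepWeight_le hq0 hq True (s i.castSucc) (s i.succ)
      simpa only [stepWeight, if_true, binomFactor, Fin.cases_succ] using h
  · have h := norm_pow_sq_mul_stepWeight_le hq0 hq False 0 (s i)
    simpa only [stepWeight, if_false] using h

/-- Each `b_i` is paired with `q^{s_i²}`, giving a product of one-variable bounds. Monotonicity is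
not needed: truncated differences still give reciprocals bounded by `C`. -/
theorem summable_baileyTerm (k : ℕ) {q : ℂ} (hq0 : q ≠ 0) (hq : ‖q‖ < 1)
    (J : Finset (Fin (k + 1))) {β : ℕ → ℂ} {B : ℝ} (hB : ∀ n, ‖β n‖ ≤ B) :
    Summable (baileyTerm k q J β) := by
  obtain ⟨C, hC0, hC⟩ := exists_norm_qPochInv_le hq
  have hs := summable_prod_apply (f := fun m => 2 * ‖q‖ ^ (m * (m - 1)))
    (fun m => by positivity) ((summable_norm_pow_mul_pred hq).mul_left 2) (k + 1)
  refine ((hs.mul_right (C ^ k)).mul_right B).of_norm_bounded fun s => ?_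
  have e : baileyTerm k q J β s =
      (∏ i, q ^ (s i ^ 2) * (if i ∈ J then binomFactor k q s i else 1)) *
      (∏ i : Fin k, qPochInv q ((s i.castSucc - s i.succ : ℕ) : ℤ)) * β (s (Fin.last k)) := by
    simp only [qPochInv_natCast]
    rw [Finset.prod_mul_distrib, Finset.prod_ite_mem, Finset.univ_inter, Finset.prod_inv_distrib,
      Finset.prod_pow_eq_pow_sum, baileyTerm]
    ring
  rw [e, norm_mul, norm_mul, norm_prod, norm_prod]
  have h2 : ∏ i : Fin k, ‖qPochInv q ((s i.castSucc - s i.succ : ℕ) : ℤ)‖ ≤ C ^ k := by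
    refine (Finset.prod_le_prod (fun i _ => norm_nonneg _) fun i _ => hC _).trans ?_
    simp
  have h1 := Finset.prod_le_prod (s := Finset.univ) (fun i _ => norm_nonneg _) fun i _ =>
    norm_pow_sq_mul_binomFactor_le k hq0 hq s J i
  gcongr
  exact hB _

/-- Summing over the last entry is one Bailey step, which yields a new pair with one variable fewer;
`k = 0` is the limiting step. -/
theorem hasSum_baileyTerm (k : ℕ) {q : ℂ} (hq0 : q ≠ 0) (hq : ‖q‖ < 1)
    (J : Finset (Fin (k + 1))) {α : ℤ → ℂ} {β : ℕ → ℂ} (h : BaileyPair q α β) (hα : Summable α) :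
    HasSum (fun s : DecTuple k => baileyTerm k q J β s.1) ((qPochInf q q)⁻¹ *
      ∑' r : ℤ, (q ^ (r ^ 2)) ^ (k + 1) * (q ^ r + q ^ (-r)) ^ J.card * α r) := by
  induction k generalizing α β with
  | zero =>
    let e : DecTuple 0 ≃ ℕ :=
      { toFun := fun s => s.1 0
        invFun := fun m => ⟨fun _ => m, fun _ _ _ => le_rfl⟩
        left_inv := fun s => by
          apply Subtype.ext
          funext i
          rw [show i = 0 from Fin.fin_one_eq_zero i]
        right_inv := fun m => rfl }
    have hs := e.hasSum_iff.mpr (h.hasSum hq0 hq hα (Fin.last 0 ∈ J))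
    have hval : ∀ r : ℤ, (q ^ (r ^ 2)) ^ (0 + 1) * (q ^ r + q ^ (-r)) ^ J.card * α r =
        stepFactor q (Fin.last 0 ∈ J) r * α r := by
      intro r
      rw [← Finset.prod_const, prod_finset_fin_castSucc, stepFactor]
      simp
    simp only [hval]
    refine hs.congr_fun fun s => ?_
    rw [baileyTerm, prod_finset_fin_castSucc]
    simp [e, binomFactor]
  | succ k ih =>
    obtain ⟨B, -, hB⟩ := h.exists_norm_le hq hα
    have hi := ih (Finset.univ.filter fun i : Fin (k + 1) => i.castSucc ∈ J)
      (h.step hq0 hq (Fin.last (k + 1) ∈ J)) (hα.stepFactor_mul hq0 hq _)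
    have hval : ∀ r : ℤ, (q ^ (r ^ 2)) ^ (k + 1 + 1) * (q ^ r + q ^ (-r)) ^ J.card * α r =
        (q ^ (r ^ 2)) ^ (k + 1) *
          (q ^ r + q ^ (-r)) ^ (Finset.univ.filter fun i : Fin (k + 1) => i.castSucc ∈ J).card *
          (stepFactor q (Fin.last (k + 1) ∈ J) r * α r) := by
      intro r
      rw [← Finset.prod_const, prod_finset_fin_castSucc, stepFactor, Finset.prod_const]
      ring
    simp only [hval]
    rw [← (decTupleSuccEquiv k).symm.hasSum_iff]
    refine hi.sigma_of_hasSum (fun t => ?_) ?_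
    · have hf := hasSum_fintype fun m : Fin (t.1 (Fin.last k) + 1) =>
        baileyTerm (k + 1) q J β (Fin.snoc (α := fun _ => ℕ) t.1 m)
      have hsum : ∑ m : Fin (t.1 (Fin.last k) + 1),
          baileyTerm (k + 1) q J β (Fin.snoc (α := fun _ => ℕ) t.1 m) =
          baileyTerm k q (Finset.univ.filter fun i : Fin (k + 1) => i.castSucc ∈ J) (fun n =>
            ∑ m ∈ Finset.range (n + 1), q ^ (m ^ 2) * stepWeight q (Fin.last (k + 1) ∈ J) n m *
              qPochInv q ((n : ℤ) - m) * β m) t.1 := by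
        rw [baileyTerm, ← Fin.sum_univ_eq_sum_range, Finset.mul_sum, Finset.mul_sum]
        exact Finset.sum_congr rfl fun m _ =>
          baileyTerm_snoc k q J β t.1 m (Nat.le_of_lt_succ m.2)
      rw [← hsum]
      exact hf
    -- Absolute convergence over all tuples justifies summing the last entry first.
    · exact ((summable_baileyTerm (k + 1) hq0 hq J hB).comp_injective
        Subtype.val_injective).comp_injective (decTupleSuccEquiv k).symm.injective

/-! ### The product side and the theorem -/

/-- The extra `(2k+2) r(r-1)/2 = (k+1)(r² - r)` in the exponent explains the shift `k + 1` in the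
argument. -/
theorem thetaCoeff_dilate {q z : ℂ} (hq0 : q ≠ 0) (k j s : ℕ) (r : ℤ) :
    thetaCoeff (q ^ (2 * k + 3)) (z * q ^ ((k : ℤ) + 1 + j - 2 * s)) r =
      (q ^ (r ^ 2)) ^ (k + 1) * q ^ (r * (j - 2 * s)) * thetaCoeff q z r := by
  have e : 2 * (r * (r - 1) / 2) = r ^ 2 - r := by
    have h2 : (2 : ℤ) ∣ r * (r - 1) := by
      have := (Int.even_mul_pred_self r).two_dvd
      exact this
    rw [Int.mul_ediv_cancel' h2]
    ring
  rw [thetaCoeff, thetaCoeff, mul_zpow, ← zpow_mul, ← zpow_natCast, ← zpow_natCast, ← zpow_mul,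
    ← zpow_mul]
  have h : q ^ ((((k : ℤ) + 1 + j - 2 * s)) * r) * q ^ (((2 * k + 3 : ℕ) : ℤ) * (r * (r - 1) / 2)) =
      q ^ (r ^ 2 * ((k + 1 : ℕ) : ℤ)) * q ^ (r * ((j : ℤ) - 2 * s)) * q ^ (r * (r - 1) / 2) := by
    simp only [← zpow_add₀ hq0]
    congr 1
    push_cast
    linear_combination ((k : ℤ) + 1) * e
  linear_combination z ^ r * h

theorem tsum_eq_overProductSide (k j : ℕ) {q z : ℂ} (hq0 : q ≠ 0) (hq : ‖q‖ < 1) (hz : z ≠ 0) :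
    (qPochInf q q)⁻¹ * ∑' r : ℤ, (q ^ (r ^ 2)) ^ (k + 1) * (q ^ r + q ^ (-r)) ^ j *
      thetaCoeff q z r = overProductSide k j q z := by
  have hQ0 : q ^ (2 * k + 3) ≠ 0 := pow_ne_zero _ hq0
  have hQ : ‖q ^ (2 * k + 3)‖ < 1 := by
    rw [norm_pow]
    exact pow_lt_one₀ (norm_nonneg q) hq (by omega)
  have hs := hasSum_sum (s := Finset.range (j + 1)) fun s _ =>
    (hasSum_thetaCoeff hQ0 hQ
      (mul_ne_zero hz (zpow_ne_zero ((k : ℤ) + 1 + j - 2 * s) hq0))).mul_left (j.choose s : ℂ)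
  have hterm : ∀ r : ℤ, (q ^ (r ^ 2)) ^ (k + 1) * (q ^ r + q ^ (-r)) ^ j * thetaCoeff q z r =
      ∑ s ∈ Finset.range (j + 1), (j.choose s : ℂ) *
        thetaCoeff (q ^ (2 * k + 3)) (z * q ^ ((k : ℤ) + 1 + j - 2 * s)) r := by
    intro r
    -- The summands are swapped so that `s` counts factors `q^{-r}`, giving the exponent `r(j -
    -- 2s)`.
    rw [add_comm (q ^ r), add_pow, Finset.mul_sum, Finset.sum_mul]
    refine Finset.sum_congr rfl fun s hs => ?_
    rw [Finset.mem_range] at hs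
    have hp : (q ^ (-r)) ^ s * (q ^ r) ^ (j - s) = q ^ (r * (j - 2 * s)) := by
      rw [← zpow_natCast, ← zpow_natCast, ← zpow_mul, ← zpow_mul, ← zpow_add₀ hq0,
        Nat.cast_sub (by omega)]
      congr 1
      ring
    rw [thetaCoeff_dilate hq0, hp]
    ring
  simp only [hterm]
  rw [hs.tsum_eq, overProductSide, Finset.mul_sum]
  refine Finset.sum_congr rfl fun s _ => ?_
  have e : -q ^ (2 * k + 3) / (z * q ^ ((k : ℤ) + 1 + j - 2 * s)) =
      -q ^ ((k : ℤ) + 2 - j + 2 * s) / z := by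
    have h1 : q ^ (2 * k + 3) =
        q ^ ((k : ℤ) + 2 - j + 2 * s) * q ^ ((k : ℤ) + 1 + j - 2 * s) := by
      rw [← zpow_add₀ hq0, ← zpow_natCast]
      congr 1
      push_cast
      ring
    have h2 := zpow_ne_zero ((k : ℤ) + 1 + j - 2 * s) hq0
    rw [h1, ← neg_mul, mul_div_mul_right _ _ h2]
  rw [e, neg_mul]
  ring

theorem prod_filter_binomFactor (k j : ℕ) {q : ℂ} (hq0 : q ≠ 0) (s : Fin (k + 1) → ℕ) :
    ∏ i : Fin (k + 1) with i.val < j, binomFactor k q s i =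
      q ^ (-∑ i : Fin (k + 1) with i.val < j, (s i : ℤ)) *
        ∏ i : Fin k with i.val + 1 < j, (1 + q ^ (s i.castSucc + s i.succ)) := by
  have hz : ∀ u : Finset (Fin (k + 1)), q ^ (-∑ i ∈ u, (s i : ℤ)) = ∏ i ∈ u, q ^ (-(s i : ℤ)) := by
    intro u
    induction u using Finset.induction_on with
    | empty => simp
    | insert a u ha ih => rw [Finset.sum_insert ha, Finset.prod_insert ha, neg_add, zpow_add₀ hq0, ih]
  rw [hz, Finset.prod_filter, Finset.prod_filter, Finset.prod_filter, Fin.prod_univ_succ,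
    Fin.prod_univ_succ, mul_assoc, ← Finset.prod_mul_distrib]
  congr 1
  refine Finset.prod_congr rfl fun i _ => ?_
  simp only [Fin.val_succ, binomFactor, Fin.cases_succ]
  split_ifs <;> simp

theorem hasSum_overTerm (k : ℕ) {q z : ℂ} (hq0 : q ≠ 0) (hq : ‖q‖ < 1) (hz : z ≠ 0)
    (J : Finset (Fin (k + 1))) :
    HasSum (fun s : DecTuple k => (∏ i ∈ J, binomFactor k q s.1 i) * overTerm k q z s.1)
      (overProductSide k J.card q z) := by
  rw [← tsum_eq_overProductSide k J.card hq0 hq hz]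
  have h := hasSum_baileyTerm k hq0 hq J (baileyPair_theta hq0 hq hz)
    (summable_thetaCoeff hq0 hq hz)
  simpa only [baileyTerm, overTerm] using h

theorem mainTheorem5 (k j : ℕ) (hj : j ≤ k + 1) (q z : ℂ) (hq0 : q ≠ 0) (hq1 : ‖q‖ < 1)
    (hz : z ≠ 0) :
    HasSum
      (fun s : DecTuple k =>
        q ^ (-∑ i : Fin (k + 1) with i.val < j, (s.1 i : ℤ)) *
          (∏ i : Fin k with i.val + 1 < j, (1 + q ^ (s.1 i.castSucc + s.1 i.succ))) *
          overTerm k q z s.1)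
      (overProductSide k j q z) ∧
    ∀ J : Finset (Fin (k + 1)), J.card = j →
      HasSum
        (fun s : DecTuple k => (∏ i ∈ J, binomFactor k q s.1 i) * overTerm k q z s.1)
        (overProductSide k j q z) := by
  have hJ : ∀ J : Finset (Fin (k + 1)), J.card = j →
      HasSum (fun s : DecTuple k => (∏ i ∈ J, binomFactor k q s.1 i) * overTerm k q z s.1)
        (overProductSide k j q z) := by
    rintro J rfl
    exact hasSum_overTerm k hq0 hq1 hz J
  refine ⟨?_, hJ⟩
  -- The displayed numerator is the case where `J` is the first `j` indices; `j ≤ k + 1` ensures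
  -- that there are `j` of them.
  have hcard : (Finset.univ.filter fun i : Fin (k + 1) => i.val < j).card = j := by
    rw [Fin.card_filter_val_lt]
    exact min_eq_right hj
  simpa only [prod_filter_binomFactor k j hq0] using hJ _ hcard
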